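/- For real $\theta$ let $|\theta\rangle=(|0\rangle+e^{i\theta}|1\rangle)/\sqrt2$, let $|CCZ\rangle=CCZ\,|+\rangle^{\otimes 3}$, and for an integer $d'\ge 0$ let $$\mathcal R_{d'}=\mathbb Z[e^{i\pi/2^{d'}},1/2]=\Big\{\tfrac1{2^m}\sum_{l=0}^{2^{d'}-1}a_l\,e^{i\pi l/2^{d'}} : a_l,m\in\mathbb Z\Big\}.$$ A stabilizer protocol is a finite adaptive sequence of Clifford unitaries, preparations of ancilla qubits in the state $|0\rangle$, discarding of qubits (partial trace) and multi-qubit Pauli measurements, where each step may depend on the earlier measurement outcomes. It has measurement probabilities $1/2$ on a given input if both outcomes of each measurement occur with probability $1/2$, conditionally on the earlier outcomes. A catalyst is a (normalized) state $|\mathrm{cat}\rangle$ of some number of qubits whose entries in the computational basis all lie in $\mathcal R_{d'}$ for some $d'$. Let $d\ge 2$ be an integer and $j$ an odd integer. Suppose that a stabilizer protocol, run on the input $|CCZ\rangle^{\otimes k}\otimes|\mathrm{cat}\rangle$ for some catalyst $|\mathrm{cat}\rangle$, has measurement probabilities $1/2$ and ends, for at least one sequence of measurement outcomes (in particular, if it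 does so for all of them), in the state $|\pi j/2^d\rangle^{\otimes n}\otimes|\mathrm{cat}\rangle$. Then $$k\;\ge\; n\Big(1-\frac1{2^{d-1}}\Big).$$ Consequently, asymptotically at least $1-1/2^{d-1}$ copies of $|CCZ\rangle$ are needed per copy of $|\pi j/2^d\rangle$: if $n_i\to\infty$ and for every $i$ such a conversion of $k_i$ states $|CCZ\rangle$ into $n_i$ states $|\pi j/2^d\rangle$ exists, with a catalyst that may depend on $i$, then $\liminf_{i\to\infty}k_i/n_i\ge 1-1/2^{d-1}$. -/

import Mathlib

namespace Stab

/-- Labels of the computational basis of `m` qubits. -/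
abbrev Basis (m : ℕ) : Type := Fin m → Fin 2

/-- State vectors (amplitudes in the computational basis) of `m` qubits. -/
abbrev Ket (m : ℕ) : Type := Basis m → ℂ

/-- Operators on `m` qubits, as matrices in the computational basis. -/
abbrev Op (m : ℕ) : Type := Matrix (Basis m) (Basis m) ℂ

/-- Unit vectors. -/
def IsUnitKet {m : ℕ} (ψ : Ket m) : Prop := ∑ x, ‖ψ x‖ ^ 2 = 1

/-- The density matrix `|ψ⟩⟨ψ|`. -/
def density {m : ℕ} (ψ : Ket m) : Op m := Matrix.vecMulVec ψ (star ψ)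

/-- The tensor product `|ψ⟩ ⊗ |φ⟩`; the qubits of `ψ` come first. -/
def tensor {a b : ℕ} (ψ : Ket a) (φ : Ket b) : Ket (a + b) :=
  fun x => ψ (fun i => x (Fin.castAdd b i)) * φ (fun i => x (Fin.natAdd a i))

/-- The tensor power `|ψ⟩^{⊗ k}`. -/
def tensorPow {a : ℕ} (ψ : Ket a) (k : ℕ) : Ket (k * a) :=
  fun x => ∏ i : Fin k, ψ (fun l => x (finProdFinEquiv (i, l)))

/-- `|CCZ⟩ = CCZ |+⟩^{⊗ 3}`. -/
noncomputable def cczKet : Ket 3 :=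
  fun x => (if ∀ i, x i = 1 then -1 else 1) / (Real.sqrt 8 : ℂ)

/-- `|θ⟩ = (|0⟩ + e^{iθ} |1⟩) / √2`. -/
noncomputable def phaseKet (θ : ℝ) : Ket 1 :=
  fun x => (if x 0 = 0 then 1 else Complex.exp (Complex.I * θ)) / (Real.sqrt 2 : ℂ)

/-- The ring `R_d = ℤ[exp(iπ/2^d), 1/2]`, given by explicit representatives. -/
def dyadicRing (d : ℕ) : Set ℂ :=
  {z | ∃ (a : ℕ → ℤ) (k : ℤ),
    z = 1 / (2 : ℂ) ^ k *
      ∑ j ∈ Finset.range (2 ^ d), (a j : ℂ) * Complex.exp (Complex.I * Real.pi * j / 2 ^ d)}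

/-- The four single-qubit Pauli labels. -/
inductive Pauli : Type
  | I
  | X
  | Y
  | Z

/-- The single-qubit Pauli matrices. -/
def Pauli.toMatrix : Pauli → Matrix (Fin 2) (Fin 2) ℂ
  | .I => 1
  | .X => !![0, 1; 1, 0]
  | .Y => !![0, -Complex.I; Complex.I, 0]
  | .Z => !![1, 0; 0, -1]

/-- The `m`-qubit Pauli observable `P 0 ⊗ ⋯ ⊗ P (m - 1)`. -/
def pauliOp {m : ℕ} (P : Fin m → Pauli) : Op m :=
  Matrix.of fun x y => ∏ i, (P i).toMatrix (x i) (y i)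

/-- Clifford unitaries: unitaries that map Pauli observables to Pauli observables, up to sign,
under conjugation. -/
def IsClifford {m : ℕ} (U : Op m) : Prop :=
  U ∈ Matrix.unitaryGroup (Basis m) ℂ ∧
    ∀ P : Fin m → Pauli, ∃ Q : Fin m → Pauli,
      U * pauliOp P * star U = pauliOp Q ∨ U * pauliOp P * star U = -pauliOp Q

/-- The projectors `(1 + P) / 2` (outcome `+1`, for `s = 1`) and `(1 - P) / 2` (outcome `-1`,
for `s = -1`) of the measurement of `P`. -/
noncomputable def outcomeProj {m : ℕ} (P : Fin m → Pauli) (s : ℤˣ) : Op m :=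
  (1 / 2 : ℂ) • (1 + ((s : ℤ) : ℂ) • pauliOp P)

/-- The probability of outcome `s` when `P` is measured in state `ρ`. -/
noncomputable def outcomeProb {m : ℕ} (P : Fin m → Pauli) (s : ℤˣ) (ρ : Op m) : ℂ :=
  (outcomeProj P s * ρ).trace

/-- The normalized state after outcome `s` of the measurement of `P` in state `ρ`. -/
noncomputable def postMeasure {m : ℕ} (P : Fin m → Pauli) (s : ℤˣ) (ρ : Op m) : Op m :=
  (outcomeProb P s ρ)⁻¹ • (outcomeProj P s * ρ * outcomeProj P s)

/-- `ρ ⊗ |0⟩⟨0|`: a fresh qubit in state `|0⟩` is appended as the last qubit. -/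
def addZero {m : ℕ} (ρ : Op m) : Op (m + 1) :=
  Matrix.of fun x y =>
    if x (Fin.last m) = 0 ∧ y (Fin.last m) = 0 then
      ρ (fun i => x i.castSucc) (fun i => y i.castSucc)
    else 0

/-- The partial trace over the last qubit. -/
def traceLast {m : ℕ} (ρ : Op (m + 1)) : Op m :=
  Matrix.of fun x y =>
    ∑ b : Fin 2, ρ (Fin.snoc (α := fun _ => Fin 2) x b) (Fin.snoc (α := fun _ => Fin 2) y b)

/-- Adaptive protocols of stabilizer operations from `m` to `l` qubits: Clifford unitaries,
preparation of `|0⟩` ancillas, discarding of qubits, and Pauli measurements whose outcome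
controls everything that follows. Other stabilizer ancillas, and the discarding of a qubit other
than the last one, are obtained with Clifford unitaries. -/
inductive Protocol : ℕ → ℕ → Type
  | done (m : ℕ) : Protocol m m
  | clifford {m l : ℕ} (U : Op m) (hU : IsClifford U) (next : Protocol m l) : Protocol m l
  | prepare {m l : ℕ} (next : Protocol (m + 1) l) : Protocol m l
  | discard {m l : ℕ} (next : Protocol m l) : Protocol (m + 1) l
  | measure {m l : ℕ} (P : Fin m → Pauli) (ifPlus ifMinus : Protocol m l) : Protocol m l

/-- Run on the input state `ρ`, every measurement of the protocol has two outcomes of probability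
`1/2` each, given the outcomes before it. -/
def Protocol.HalfProb : {m l : ℕ} → Protocol m l → Op m → Prop
  | _, _, .done _, _ => True
  | _, _, .clifford U _ next, ρ => next.HalfProb (U * ρ * star U)
  | _, _, .prepare next, ρ => next.HalfProb (addZero ρ)
  | _, _, .discard next, ρ => next.HalfProb (traceLast ρ)
  | _, _, .measure P p q, ρ =>
      (outcomeProb P 1 ρ = 1 / 2 ∧ outcomeProb P (-1) ρ = 1 / 2) ∧
        p.HalfProb (postMeasure P 1 ρ) ∧ q.HalfProb (postMeasure P (-1) ρ)

/-- Run on the input state `ρ`, the protocol ends in the state `σ` for at least one sequence of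
measurement outcomes. -/
def Protocol.HasOutput : {m l : ℕ} → Protocol m l → Op m → Op l → Prop
  | _, _, .done _, ρ, σ => σ = ρ
  | _, _, .clifford U _ next, ρ, σ => next.HasOutput (U * ρ * star U) σ
  | _, _, .prepare next, ρ, σ => next.HasOutput (addZero ρ) σ
  | _, _, .discard next, ρ, σ => next.HasOutput (traceLast ρ) σ
  | _, _, .measure P p q, ρ, σ =>
      p.HasOutput (postMeasure P 1 ρ) σ ∨ q.HasOutput (postMeasure P (-1) ρ) σ

/-- Stabilizer operations with measurement probabilities `1/2` can convert `k` states `|CCZ⟩` into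
`n` states `|θ⟩` with the help of the catalyst `|cat⟩`, which is returned at the end. -/
def ConvertsCCZ {c : ℕ} (cat : Ket c) (k n : ℕ) (θ : ℝ) : Prop :=
  ∃ p : Protocol (k * 3 + c) (n * 1 + c),
    p.HalfProb (density (tensor (tensorPow cczKet k) cat)) ∧
      p.HasOutput (density (tensor (tensorPow cczKet k) cat))
        (density (tensor (tensorPow (phaseKet θ) n) cat))

/-- A state that is admitted as a catalyst: a unit vector with all entries in `R_{d'}` for
some `d'`. -/
def IsDyadicState {c : ℕ} (cat : Ket c) : Prop :=
  IsUnitKet cat ∧ ∃ d' : ℕ, ∀ x, cat x ∈ dyadicRing d'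

end Stab

namespace Stab

open Matrix

/-! ### Pauli algebra -/

/-! The invariant is the 2-adic size of Pauli expectations. Extend the 2-adic valuation to a
multiplicative valuation `v` on `ℂ` with `v 2 < 1`. A measurement outcome of probability 1/2
replaces the expectation of `Q` by 0 or by a sum of an old expectation and a unit multiple of
another, with no division by 2. So an upper bound on `v` of all Pauli expectations survives the
whole protocol (`Protocol.pauliExpIn_of_hasOutput`).

Expectations of `|CCZ⟩` are half-integers up to powers of `i`, so each copy contributes at most `(v
2)⁻¹`. On the target, measuring `X` on every copy gives `cos θ ^ n`. The catalyst enters both sides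
through the largest valuation `M` of its expectations, which is positive and cancels. Hence `v (cos
θ) ^ n ≤ (v 2)⁻¹ ^ k` (`ConvertsCCZ.valuation_cos_pow_le`). For `θ = πj/2^d`, `2 cos θ` is a unit
times `1 - ζ` with `ζ` of order `2^d`, so `v (2 cos θ)` is a `2^(d-1)`-th root of `v 2`; comparing
exponents gives the bound. -/

instance : Finite Pauli :=
  Finite.of_surjective
    (fun i : Fin 4 => match i with | 0 => Pauli.I | 1 => Pauli.X | 2 => Pauli.Y | 3 => Pauli.Z)
    (fun P => by
      cases P
      exacts [⟨0, rfl⟩, ⟨1, rfl⟩, ⟨2, rfl⟩, ⟨3, rfl⟩])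

/-- The tensor product of a family of single-qubit operators. -/
def localOp {m : ℕ} (A : Fin m → Matrix (Fin 2) (Fin 2) ℂ) : Op m :=
  Matrix.of fun x y => ∏ i, A i (x i) (y i)

theorem pauliOp_eq_localOp {m : ℕ} (P : Fin m → Pauli) :
    pauliOp P = localOp fun i => (P i).toMatrix := rfl

theorem localOp_mul {m : ℕ} (A B : Fin m → Matrix (Fin 2) (Fin 2) ℂ) :
    localOp A * localOp B = localOp fun i => A i * B i := by
  ext x y
  simp only [localOp, Matrix.mul_apply, Matrix.of_apply]
  rw [Finset.prod_univ_sum, Fintype.piFinset_univ]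
  simp only [Finset.prod_mul_distrib]

theorem localOp_smul {m : ℕ} (c : Fin m → ℂ) (A : Fin m → Matrix (Fin 2) (Fin 2) ℂ) :
    (localOp fun i => c i • A i) = (∏ i, c i) • localOp A := by
  ext x y
  simp [localOp, Finset.prod_mul_distrib]

theorem localOp_one {m : ℕ} :
    localOp (fun _ : Fin m => (1 : Matrix (Fin 2) (Fin 2) ℂ)) = 1 := by
  ext x y
  simp only [localOp, Matrix.of_apply, Matrix.one_apply, funext_iff]
  rw [Finset.prod_ite_zero]
  simp

theorem Pauli.exists_mul_eq (P Q : Pauli) :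
    ∃ (R : Pauli) (c : ℂ), c ^ 4 = 1 ∧ P.toMatrix * Q.toMatrix = c • R.toMatrix := by
  have hI : Complex.I ^ 4 = 1 := Complex.I_pow_four
  have hI' : (-Complex.I) ^ 4 = 1 := by rw [neg_pow, hI]; norm_num
  cases P <;> cases Q
  · exact ⟨.I, 1, by simp, by simp [Pauli.toMatrix]⟩
  · exact ⟨.X, 1, by simp, by simp [Pauli.toMatrix]⟩
  · exact ⟨.Y, 1, by simp, by simp [Pauli.toMatrix]⟩
  · exact ⟨.Z, 1, by simp, by simp [Pauli.toMatrix]⟩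
  · exact ⟨.X, 1, by simp, by simp [Pauli.toMatrix]⟩
  · exact ⟨.I, 1, by simp, by simp [Pauli.toMatrix, Matrix.one_fin_two]⟩
  · exact ⟨.Z, Complex.I, hI, by simp [Pauli.toMatrix]⟩
  · exact ⟨.Y, -Complex.I, hI', by simp [Pauli.toMatrix]⟩
  · exact ⟨.Y, 1, by simp, by simp [Pauli.toMatrix]⟩
  · exact ⟨.Z, -Complex.I, hI', by simp [Pauli.toMatrix]⟩
  · exact ⟨.I, 1, by simp, by simp [Pauli.toMatrix, Matrix.one_fin_two]⟩
  · exact ⟨.X, Complex.I, hI, by simp [Pauli.toMatrix]⟩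
  · exact ⟨.Z, 1, by simp, by simp [Pauli.toMatrix]⟩
  · exact ⟨.Y, Complex.I, hI, by simp [Pauli.toMatrix]⟩
  · exact ⟨.X, -Complex.I, hI', by simp [Pauli.toMatrix]⟩
  · exact ⟨.I, 1, by simp, by simp [Pauli.toMatrix, Matrix.one_fin_two]⟩

theorem Pauli.mul_comm_or_anticomm (P Q : Pauli) :
    ∃ e : ℤˣ, P.toMatrix * Q.toMatrix = ((e : ℤ) : ℂ) • (Q.toMatrix * P.toMatrix) := by
  cases P <;> cases Q <;>
    first
    | (refine ⟨1, ?_⟩; simp [Pauli.toMatrix]; done)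
    | (refine ⟨-1, ?_⟩; simp [Pauli.toMatrix])

theorem Pauli.mul_self (P : Pauli) : P.toMatrix * P.toMatrix = 1 := by
  cases P <;> simp [Pauli.toMatrix, Matrix.one_fin_two]

theorem exists_pauliOp_mul_eq {m : ℕ} (P Q : Fin m → Pauli) :
    ∃ (R : Fin m → Pauli) (c : ℂ), c ^ 4 = 1 ∧ pauliOp P * pauliOp Q = c • pauliOp R := by
  choose R c hc h using fun i => (P i).exists_mul_eq (Q i)
  refine ⟨R, ∏ i, c i, by simp [← Finset.prod_pow, hc], ?_⟩
  simp only [pauliOp_eq_localOp, localOp_mul, h, localOp_smul]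

theorem pauliOp_comm_or_anticomm {m : ℕ} (P Q : Fin m → Pauli) :
    pauliOp P * pauliOp Q = pauliOp Q * pauliOp P ∨
      pauliOp P * pauliOp Q = -(pauliOp Q * pauliOp P) := by
  choose e h using fun i => (P i).mul_comm_or_anticomm (Q i)
  have key : pauliOp P * pauliOp Q =
      (((∏ i, e i : ℤˣ) : ℤ) : ℂ) • (pauliOp Q * pauliOp P) := by
    simp only [pauliOp_eq_localOp, localOp_mul, h, localOp_smul]
    push_cast
    rfl
  rcases Int.units_eq_one_or (∏ i, e i) with h1 | h1 <;> rw [h1] at key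
  · left; simpa using key
  · right; simpa using key

theorem pauliOp_mul_self {m : ℕ} (P : Fin m → Pauli) : pauliOp P * pauliOp P = 1 := by
  simp only [pauliOp_eq_localOp, localOp_mul, Pauli.mul_self, localOp_one]

/-! ### Pauli expectations and stabilizer operations -/

/-- The expectation of the Pauli observable `P` in the state `ρ`. -/
def pauliExp {m : ℕ} (P : Fin m → Pauli) (ρ : Op m) : ℂ := (pauliOp P * ρ).trace

/-- All Pauli expectations of `ρ` lie in `S`. -/
def PauliExpIn {m : ℕ} (S : AddSubgroup ℂ) (ρ : Op m) : Prop := ∀ P, pauliExp P ρ ∈ S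

/-- The conjugate of a Clifford unitary also maps Pauli observables to Pauli observables. -/
theorem IsClifford.exists_star_conj {m : ℕ} {U : Op m} (hU : IsClifford U)
    (P : Fin m → Pauli) :
    ∃ Q : Fin m → Pauli,
      star U * pauliOp P * U = pauliOp Q ∨ star U * pauliOp P * U = -pauliOp Q := by
  obtain ⟨hu, hP⟩ := hU
  have h1 : star U * U = 1 := Matrix.mem_unitaryGroup_iff'.1 hu
  let T : Set (Op m) := Set.range pauliOp ∪ Set.range fun Q : Fin m → Pauli => -pauliOp Q
  have hT : T.Finite := (Set.finite_range _).union (Set.finite_range _)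
  have hinv : ∀ A : Op m, star U * (U * A * star U) * U = A := fun A => by
    calc star U * (U * A * star U) * U = (star U * U) * A * (star U * U) := by noncomm_ring
      _ = A := by rw [h1]; simp
  have hmaps : Set.MapsTo (fun A => U * A * star U) T T := by
    rintro _ (⟨Q, rfl⟩ | ⟨Q, rfl⟩)
    · obtain ⟨R, hR | hR⟩ := hP Q
      · exact Or.inl ⟨R, hR.symm⟩
      · exact Or.inr ⟨R, hR.symm⟩
    · obtain ⟨R, hR | hR⟩ := hP Q
      · exact Or.inr ⟨R, by simp [hR]⟩
      · exact Or.inl ⟨R, by simp [hR]⟩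
  have hinj : Set.InjOn (fun A => U * A * star U) T := fun A _ B _ hAB => by
    rw [← hinv A, ← hinv B]
    exact congrArg (fun C => star U * C * U) hAB
  -- An injective self-map of the finite set of signed Paulis is onto.
  obtain ⟨A, hA, hAP⟩ := ((hT.injOn_iff_bijOn_of_mapsTo hmaps).1 hinj).surjOn
    (show pauliOp P ∈ T from Or.inl ⟨P, rfl⟩)
  have hA' : star U * pauliOp P * U = A := by rw [← hAP]; exact hinv A
  rw [hA']
  rcases hA with ⟨Q, rfl⟩ | ⟨Q, rfl⟩
  · exact ⟨Q, Or.inl rfl⟩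
  · exact ⟨Q, Or.inr rfl⟩

theorem PauliExpIn.clifford {m : ℕ} {S : AddSubgroup ℂ} {ρ U : Op m} (h : PauliExpIn S ρ)
    (hU : IsClifford U) : PauliExpIn S (U * ρ * star U) := fun P => by
  have key : pauliExp P (U * ρ * star U) = (star U * pauliOp P * U * ρ).trace := by
    rw [pauliExp, ← Matrix.mul_assoc, Matrix.trace_mul_comm]
    simp only [Matrix.mul_assoc]
  rw [key]
  obtain ⟨Q, hQ | hQ⟩ := hU.exists_star_conj P <;> rw [hQ]
  · exact h Q
  · rw [Matrix.neg_mul, Matrix.trace_neg]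
    exact S.neg_mem (h Q)

theorem Basis.sum_snoc {m : ℕ} (f : Basis (m + 1) → ℂ) :
    ∑ x, f x = ∑ x : Basis m, ∑ b : Fin 2, f (Fin.snoc (α := fun _ => Fin 2) x b) := by
  rw [← (Fin.snocEquiv fun _ => Fin 2).sum_comp, Fintype.sum_prod_type_right]
  rfl

theorem pauliExp_eq_sum {m : ℕ} (P : Fin m → Pauli) (ρ : Op m) :
    pauliExp P ρ = ∑ x, ∑ y, (∏ i, (P i).toMatrix (x i) (y i)) * ρ y x := by
  simp [pauliExp, Matrix.trace, Matrix.mul_apply, pauliOp]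

/-- The last factor contributes `⟨0|P|0⟩`, which is 1 for `I`, `Z` and 0 for `X`, `Y`. -/
theorem PauliExpIn.addZero {m : ℕ} {S : AddSubgroup ℂ} {ρ : Op m} (h : PauliExpIn S ρ) :
    PauliExpIn S (addZero ρ) := fun P => by
  have key : pauliExp P (Stab.addZero ρ) =
      (P (Fin.last m)).toMatrix 0 0 * pauliExp (fun i => P i.castSucc) ρ := by
    simp only [pauliExp_eq_sum, Basis.sum_snoc, Stab.addZero, Matrix.of_apply,
      Fin.prod_univ_castSucc, Fin.snoc_castSucc, Fin.snoc_last, Fin.sum_univ_two]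
    simp only [Finset.mul_sum]
    simp
    exact Finset.sum_congr rfl fun x _ => Finset.sum_congr rfl fun y _ => by ring
  rw [key]
  have := h fun i => P i.castSucc
  cases P (Fin.last m) <;> simp [Pauli.toMatrix, this]

theorem PauliExpIn.traceLast {m : ℕ} {S : AddSubgroup ℂ} {ρ : Op (m + 1)}
    (h : PauliExpIn S ρ) : PauliExpIn S (traceLast ρ) := fun P => by
  have key : pauliExp P (Stab.traceLast ρ) =
      pauliExp (Fin.snoc (α := fun _ => Pauli) P Pauli.I) ρ := by
    simp only [pauliExp_eq_sum, Basis.sum_snoc, Stab.traceLast, Matrix.of_apply,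
      Fin.prod_univ_castSucc, Fin.snoc_castSucc, Fin.snoc_last, Fin.sum_univ_two]
    simp [Pauli.toMatrix, mul_add, Finset.sum_add_distrib]
  rw [key]
  exact h _

theorem mul_mem_of_pow_four_eq_one {S : AddSubgroup ℂ} (hS : ∀ z ∈ S, Complex.I * z ∈ S)
    {c z : ℂ} (hc : c ^ 4 = 1) (hz : z ∈ S) : c * z ∈ S := by
  have : (c - 1) * (c + 1) * ((c - Complex.I) * (c + Complex.I)) = 0 := by
    linear_combination hc - (c ^ 2 - 1) * Complex.I_sq
  rcases mul_eq_zero.1 this with h | h <;> rcases mul_eq_zero.1 h with h | h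
  · rw [sub_eq_zero.1 h]; simpa
  · rw [eq_neg_of_add_eq_zero_left h]; simpa
  · rw [sub_eq_zero.1 h]; exact hS z hz
  · rw [eq_neg_of_add_eq_zero_left h, neg_mul]; exact S.neg_mem (hS z hz)

/-- With `Π = (1 + sP)/2`, the product `Π Q Π` is `(Q + sPQ)/2` if `P` and `Q` commute and 0
otherwise. Normalizing by the probability 1/2 cancels the denominator, and `PQ` is a Pauli up to a
power of `i`; hence the closure of `S` under `i`. -/
theorem PauliExpIn.postMeasure {m : ℕ} {S : AddSubgroup ℂ}
    (hS : ∀ z ∈ S, Complex.I * z ∈ S) {ρ : Op m} (h : PauliExpIn S ρ) (P : Fin m → Pauli)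
    (s : ℤˣ) (hs : outcomeProb P s ρ = 1 / 2) : PauliExpIn S (postMeasure P s ρ) := fun Q => by
  have hss : ((s : ℤ) : ℂ) * ((s : ℤ) : ℂ) = 1 := by
    rcases Int.units_eq_one_or s with rfl | rfl <;> simp
  have hPP := pauliOp_mul_self P
  set e : ℂ := ((s : ℤ) : ℂ) with he
  have key : pauliExp Q (Stab.postMeasure P s ρ) =
      2 * ((outcomeProj P s * pauliOp Q * outcomeProj P s) * ρ).trace := by
    rw [pauliExp, Stab.postMeasure, hs, Matrix.mul_smul, Matrix.trace_smul, ← Matrix.mul_assoc,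
      Matrix.trace_mul_comm]
    simp [Matrix.mul_assoc]
  rw [key, outcomeProj, ← he]
  have h4 : 1 / 2 * e * (1 / 2 * e) = 1 / 4 := by linear_combination hss / 4
  have expand : (1 / 2 : ℂ) • (1 + e • pauliOp P) * pauliOp Q * (1 / 2 : ℂ) • (1 + e • pauliOp P) =
      (1 / 4 : ℂ) • pauliOp Q + (1 / 4 * e) • (pauliOp P * pauliOp Q) +
        ((1 / 4 * e) • (pauliOp Q * pauliOp P) +
          (1 / 4 : ℂ) • (pauliOp P * (pauliOp Q * pauliOp P))) := by
    simp only [Matrix.smul_mul, Matrix.mul_smul, Matrix.add_mul, Matrix.mul_add, Matrix.one_mul,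
      Matrix.mul_one, smul_smul, smul_add, h4, Matrix.mul_assoc]
    module
  rcases pauliOp_comm_or_anticomm P Q with hc | hc
  · have hc' : pauliOp P * (pauliOp Q * pauliOp P) = pauliOp Q := by
      rw [← hc, ← Matrix.mul_assoc, hPP, Matrix.one_mul]
    obtain ⟨R, c, hc4, hR⟩ := exists_pauliOp_mul_eq P Q
    have : 2 * (((1 / 4 : ℂ) • pauliOp Q + (1 / 4 * e) • (c • pauliOp R) +
        ((1 / 4 * e) • (c • pauliOp R) + (1 / 4 : ℂ) • pauliOp Q)) * ρ).trace =
        pauliExp Q ρ + e * (c * pauliExp R ρ) := by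
      simp only [pauliExp, Matrix.add_mul, Matrix.smul_mul, Matrix.trace_add, Matrix.trace_smul,
        smul_eq_mul]
      ring
    rw [expand, hc', ← hc, hR, this]
    have hm := mul_mem_of_pow_four_eq_one hS hc4 (h R)
    refine S.add_mem (h Q) ?_
    rcases Int.units_eq_one_or s with rfl | rfl
    · simpa [he] using hm
    · simpa [he] using S.neg_mem hm
  · have hc' : pauliOp P * (pauliOp Q * pauliOp P) = -pauliOp Q := by
      rw [← neg_eq_iff_eq_neg.2 hc, Matrix.mul_neg, ← Matrix.mul_assoc, hPP, Matrix.one_mul]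
    have : (1 / 4 : ℂ) • pauliOp Q + (1 / 4 * e) • -(pauliOp Q * pauliOp P) +
        ((1 / 4 * e) • (pauliOp Q * pauliOp P) + (1 / 4 : ℂ) • -pauliOp Q) = 0 := by
      module
    rw [expand, hc', hc, this]
    simp

theorem Protocol.pauliExpIn_of_hasOutput {S : AddSubgroup ℂ}
    (hS : ∀ z ∈ S, Complex.I * z ∈ S) {m l : ℕ} (p : Protocol m l) {ρ : Op m} {σ : Op l}
    (hρ : PauliExpIn S ρ) (hp : p.HalfProb ρ) (hσ : p.HasOutput ρ σ) : PauliExpIn S σ := by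
  induction p with
  | done m => simp only [Protocol.HasOutput] at hσ; rwa [hσ]
  | clifford U hU next ih => exact ih (hρ.clifford hU) hp hσ
  | prepare next ih => exact ih hρ.addZero hp hσ
  | discard next ih => exact ih hρ.traceLast hp hσ
  | measure P p q ihp ihq =>
    obtain ⟨⟨h1, h2⟩, hp, hq⟩ := hp
    rcases hσ with hσ | hσ
    · exact ihp (hρ.postMeasure hS P 1 h1) hp hσ
    · exact ihq (hρ.postMeasure hS P (-1) h2) hq hσ

/-! ### A valuation on `ℂ` above the prime `2` -/

/-- Since 2 is not a unit in `ℤ`, some valuation ring of `ℂ` has the ideal `(2)` among its nonunits.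
-/
theorem exists_valuationSubring_two_lt_one :
    ∃ B : ValuationSubring ℂ, B.valuation 2 < 1 := by
  obtain ⟨B, -, hB⟩ := Ideal.image_subset_nonunits_valuationSubring
    (A := (Int.castRingHom ℂ).range) (Ideal.span {2}) (by
      rw [Ne, Ideal.span_singleton_eq_top]
      rintro h
      obtain ⟨⟨_, n, rfl⟩, hn⟩ := h.exists_right_inv
      have h2 : (2 : ℂ) * (n : ℂ) = 1 := congrArg Subtype.val hn
      have h3 : (2 : ℤ) * n = 1 := by exact_mod_cast h2
      omega)
  exact ⟨B, B.mem_nonunits_iff.1 <| hB ⟨2, Ideal.subset_span rfl, rfl⟩⟩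

section Valuation

variable {Γ : Type*} [LinearOrderedCommGroupWithZero Γ] (v : Valuation ℂ Γ)

theorem valuation_intCast_le_one (n : ℤ) : v (n : ℂ) ≤ 1 := by
  have h (n : ℕ) : v (n : ℂ) ≤ 1 := by
    induction n with
    | zero => simp
    | succ n ih => push_cast; exact v.map_add_le ih v.map_one.le
  obtain ⟨n, rfl | rfl⟩ := n.eq_nat_or_neg
  · exact_mod_cast h n
  · simpa using h n

theorem valuation_eq_one_of_pow_eq_one {z : ℂ} {n : ℕ} (hn : n ≠ 0) (hz : z ^ n = 1) :
    v z = 1 := by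
  rw [← pow_eq_one_iff_of_nonneg zero_le hn, ← map_pow, hz, map_one]

theorem valuation_one_sub_pow_le {z : ℂ} (hz : v z = 1) (n : ℕ) :
    v (1 - z ^ n) ≤ v (1 - z) := by
  induction n with
  | zero => simp
  | succ n ih =>
    have : 1 - z ^ (n + 1) = (1 - z) + z * (1 - z ^ n) := by ring
    rw [this]
    refine v.map_add_le le_rfl ?_
    rwa [map_mul, hz, one_mul]

/-- Induct through `1 - z² = (1 - z)(1 + z)`. For positive exponent the two factors have equal
valuation, because `z` and `-z` are powers of each other, with exponent `2 ^ (r + 1) + 1` in the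
inductive step. -/
theorem valuation_one_sub_pow_eq {z : ℂ} (r : ℕ) (hz : z ^ 2 ^ r = -1) :
    v (1 - z) ^ 2 ^ r = v 2 := by
  induction r generalizing z with
  | zero =>
    obtain rfl : z = -1 := by simpa using hz
    norm_num
  | succ r ih =>
    have hz1 : v z = 1 := valuation_eq_one_of_pow_eq_one v (n := 2 ^ (r + 1) * 2) (by positivity)
      (by rw [pow_mul, hz]; norm_num)
    have h1 : v (1 + z) ≤ v (1 - z) := by
      have := valuation_one_sub_pow_le v hz1 (2 ^ (r + 1) + 1)
      rwa [pow_succ, hz, neg_one_mul, sub_neg_eq_add] at this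
    have h2 : v (1 - z) ≤ v (1 + z) := by
      have := valuation_one_sub_pow_le v (z := -z) (by rwa [Valuation.map_neg]) (2 ^ (r + 1) + 1)
      rw [pow_succ, Even.neg_pow (by simp [Nat.even_pow]), hz] at this
      simpa using this
    have h3 := ih (z := z ^ 2) (by rw [← pow_mul, ← pow_succ', hz])
    rw [← h3, show (1 - z ^ 2) = (1 - z) * (1 + z) by ring, map_mul, le_antisymm h1 h2,
      ← pow_two, ← pow_mul, ← pow_succ']

/-- The valuation of `2 cos (π j / 2 ^ d)`. -/
theorem valuation_two_mul_cos_pow {d : ℕ} (hd : 2 ≤ d) {j : ℤ} (hj : Odd j) :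
    v (2 * Complex.cos (Real.pi * j / 2 ^ d)) ^ 2 ^ (d - 1) = v 2 := by
  obtain ⟨r, rfl⟩ : ∃ r, d = r + 2 := ⟨d - 2, by omega⟩
  set t : ℂ := Real.pi * j / 2 ^ (r + 2) with ht
  have hexp : Complex.exp (t * Complex.I) ^ 2 ^ (r + 2) = -1 := by
    rw [← Complex.exp_nat_mul]
    have : ((2 ^ (r + 2) : ℕ) : ℂ) * (t * Complex.I) = j * (Real.pi * Complex.I) := by
      rw [ht]; push_cast; field_simp
    rw [this, Complex.exp_int_mul, Complex.exp_pi_mul_I, hj.neg_one_zpow]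
  set z := Complex.exp (t * Complex.I) with hzdef
  have hz1 : v z = 1 := valuation_eq_one_of_pow_eq_one v (n := 2 ^ (r + 2) * 2) (by positivity)
      (by rw [pow_mul, hexp]; norm_num)
  have hcos : z * (2 * Complex.cos t) = 1 - -z ^ 2 := by
    rw [Complex.two_cos, mul_add, ← hzdef, hzdef, ← Complex.exp_add (t * Complex.I) (-t * _)]
    simp
    ring
  -- The exponent `2 ^ (r + 1)` is even, so the sign of `-z ^ 2` disappears; this is where `2 ≤ d`
  -- matters.
  have h := valuation_one_sub_pow_eq v (z := -z ^ 2) (r + 1) (by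
    rw [Even.neg_pow (by simp [Nat.even_pow]), ← pow_mul, ← pow_succ', hexp])
  rw [← hcos, map_mul, hz1, one_mul] at h
  exact h

end Valuation

/-! ### Pauli expectations of product states -/

theorem pauliExp_density {m : ℕ} (P : Fin m → Pauli) (ψ : Ket m) :
    pauliExp P (density ψ) =
      ∑ x, ∑ y, (∏ i, (P i).toMatrix (x i) (y i)) * (ψ y * star (ψ x)) := by
  simp [pauliExp_eq_sum, density, Matrix.vecMulVec_apply]

theorem pauliExp_one_density {m : ℕ} {ψ : Ket m} (hψ : IsUnitKet ψ) :
    pauliExp (fun _ => Pauli.I) (density ψ) = 1 := by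
  have h1 : pauliOp (fun _ : Fin m => Pauli.I) = 1 := localOp_one
  rw [pauliExp, h1, Matrix.one_mul]
  have h2 : ((∑ x, ‖ψ x‖ ^ 2 : ℝ) : ℂ) = 1 := by rw [hψ]; simp
  rw [← h2, Matrix.trace]
  push_cast
  refine Finset.sum_congr rfl fun x _ => ?_
  simp [density, Matrix.vecMulVec_apply, Complex.mul_conj, Complex.normSq_eq_norm_sq]

theorem pauliExp_density_tensor {a b : ℕ} (P : Fin (a + b) → Pauli) (ψ : Ket a) (φ : Ket b) :
    pauliExp P (density (tensor ψ φ)) =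
      pauliExp (fun i => P (Fin.castAdd b i)) (density ψ) *
        pauliExp (fun i => P (Fin.natAdd a i)) (density φ) := by
  simp only [pauliExp_density]
  have hsum (f : Basis (a + b) → ℂ) :
      ∑ x, f x = ∑ x : Basis a, ∑ y : Basis b, f (Fin.append x y) := by
    rw [← (Fin.appendEquiv a b).sum_comp, Fintype.sum_prod_type]
    rfl
  simp only [hsum, Fin.prod_univ_add, tensor, Fin.append_left, Fin.append_right]
  rw [Finset.sum_mul_sum]
  refine Finset.sum_congr rfl fun x _ => Finset.sum_congr rfl fun x' _ => ?_
  rw [Finset.sum_mul_sum]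
  refine Finset.sum_congr rfl fun y _ => Finset.sum_congr rfl fun y' _ => ?_
  rw [star_mul']
  ring

theorem pauliExp_density_tensorPow {a : ℕ} (k : ℕ) (P : Fin (k * a) → Pauli) (ψ : Ket a) :
    pauliExp P (density (tensorPow ψ k)) =
      ∏ i : Fin k, pauliExp (fun l => P (finProdFinEquiv (i, l))) (density ψ) := by
  have hsum (f : Basis (k * a) → ℂ) :
      ∑ x, f x = ∑ x : Fin k → Basis a,
        f fun q => x (finProdFinEquiv.symm q).1 (finProdFinEquiv.symm q).2 := by
    rw [← (((Equiv.curry _ _ _).symm.trans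
      (finProdFinEquiv.arrowCongr (Equiv.refl (Fin 2)))) : (Fin k → Basis a) ≃ _).sum_comp]
    rfl
  simp only [pauliExp_density, hsum, tensorPow]
  rw [Finset.prod_univ_sum, Fintype.piFinset_univ]
  refine Finset.sum_congr rfl fun x _ => ?_
  rw [Finset.prod_univ_sum, Fintype.piFinset_univ]
  refine Finset.sum_congr rfl fun y _ => ?_
  rw [← finProdFinEquiv.prod_comp, Fintype.prod_prod_type, star_prod, ← Finset.prod_mul_distrib,
    ← Finset.prod_mul_distrib]
  simp

/-! ### The state `|CCZ⟩` -/

/-- The sign of `|CCZ⟩` at a basis vector. -/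
def cczSign (x : Basis 3) : ℤ := if ∀ i, x i = 1 then -1 else 1

/-- The integer matrix of `X ^ a Z ^ b`, up to a power of `i` a general Pauli matrix. -/
def pauliSign (a b x y : Fin 2) : ℤ := if y = x + a then (-1) ^ (b * x).val else 0

theorem Pauli.exists_eq_pauliSign (P : Pauli) :
    ∃ (c : ℂ) (a b : Fin 2), c ^ 4 = 1 ∧ ∀ x y, P.toMatrix x y = c * pauliSign a b x y := by
  cases P
  · exact ⟨1, 0, 0, by simp, by simp [Fin.forall_fin_two, Pauli.toMatrix, pauliSign]⟩
  · exact ⟨1, 1, 0, by simp, by simp [Fin.forall_fin_two, Pauli.toMatrix, pauliSign]⟩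
  · exact ⟨-Complex.I, 1, 1, by rw [neg_pow, Complex.I_pow_four]; norm_num,
      by simp [Fin.forall_fin_two, Pauli.toMatrix, pauliSign]⟩
  · exact ⟨1, 0, 1, by simp, by simp [Fin.forall_fin_two, Pauli.toMatrix, pauliSign]⟩

/-- A finite check over the 64 Paulis. The normalization of `|CCZ⟩` is 1/8, so divisibility by 4
leaves only a denominator 2. -/
theorem four_dvd_sum_cczSign (a b : Fin 3 → Fin 2) :
    4 ∣ ∑ x : Basis 3, ∑ y : Basis 3,
      (∏ i, pauliSign (a i) (b i) (x i) (y i)) * (cczSign y * cczSign x) := by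
  revert a b
  decide +kernel

theorem exists_pauliExp_ccz_eq (P : Fin 3 → Pauli) :
    ∃ (c : ℂ) (n : ℤ), c ^ 4 = 1 ∧ pauliExp P (density cczKet) = c * n / 2 := by
  choose c a b hc h using fun i => (P i).exists_eq_pauliSign
  obtain ⟨n, hn⟩ := four_dvd_sum_cczSign a b
  refine ⟨∏ i, c i, n, by simp [← Finset.prod_pow, hc], ?_⟩
  have h8 : ((Real.sqrt 8 : ℝ) : ℂ) * ((Real.sqrt 8 : ℝ) : ℂ) = 8 := by
    rw [← Complex.ofReal_mul, Real.mul_self_sqrt (by norm_num)]; norm_num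
  have hψ (x y : Basis 3) : cczKet y * star (cczKet x) = (cczSign y * cczSign x : ℤ) / 8 := by
    rw [← h8]
    simp only [cczKet, cczSign]
    split_ifs <;> simp [div_eq_mul_inv]
  have hn' : (4 * n : ℂ) = ((4 * n : ℤ) : ℂ) := by push_cast; rfl
  have : (∏ i, c i) * n / 2 = (∏ i, c i) / 8 * (4 * n) := by ring
  rw [this, hn', ← hn, pauliExp_density]
  push_cast
  simp only [Finset.mul_sum]
  refine Finset.sum_congr rfl fun x _ => Finset.sum_congr rfl fun y _ => ?_
  rw [hψ]
  simp only [h, Finset.prod_mul_distrib]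
  push_cast
  ring

/-! ### The states `|θ⟩` -/

theorem pauliExp_X_phase (θ : ℝ) :
    pauliExp (fun _ => Pauli.X) (density (phaseKet θ)) = Complex.cos θ := by
  have h2 : ((Real.sqrt 2 : ℝ) : ℂ) * ((Real.sqrt 2 : ℝ) : ℂ) = 2 := by
    rw [← Complex.ofReal_mul, Real.mul_self_sqrt (by norm_num)]; norm_num
  have hsum (f : Basis 1 → ℂ) : ∑ x, f x = f (fun _ => 0) + f (fun _ => 1) := by
    rw [← (Equiv.funUnique (Fin 1) (Fin 2)).symm.sum_comp, Fin.sum_univ_two]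
    rfl
  rw [pauliExp_density, Complex.cos]
  simp only [hsum]
  have h2' : ((Real.sqrt 2 : ℝ) : ℂ)⁻¹ * ((Real.sqrt 2 : ℝ) : ℂ)⁻¹ = 1 / 2 := by
    rw [← mul_inv, h2, one_div]
  simp [Pauli.toMatrix, phaseKet, ← Complex.exp_conj]
  rw [mul_comm (θ : ℂ)]
  linear_combination (Complex.exp (Complex.I * θ) + Complex.exp (-(Complex.I * θ))) * h2'

/-! ### The bound on the number of `|CCZ⟩` states -/

theorem valuation_pauliExp_ccz_le {Γ : Type*} [LinearOrderedCommGroupWithZero Γ]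
    (v : Valuation ℂ Γ) (P : Fin 3 → Pauli) : v (pauliExp P (density cczKet)) ≤ (v 2)⁻¹ := by
  obtain ⟨c, n, hc, h⟩ := exists_pauliExp_ccz_eq P
  rw [h, map_div₀, map_mul, valuation_eq_one_of_pow_eq_one v (by norm_num) hc, one_mul,
    div_eq_mul_inv]
  exact mul_le_of_le_one_left zero_le (valuation_intCast_le_one v n)

theorem ConvertsCCZ.valuation_cos_pow_le {Γ : Type*} [LinearOrderedCommGroupWithZero Γ]
    (v : Valuation ℂ Γ) {c : ℕ} {cat : Ket c} (hcat : IsUnitKet cat) {k n : ℕ} {θ : ℝ}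
    (h : ConvertsCCZ cat k n θ) : v (Complex.cos θ) ^ n ≤ (v 2)⁻¹ ^ k := by
  obtain ⟨p, hp, hout⟩ := h
  have : Nonempty (Fin c → Pauli) := ⟨fun _ => Pauli.I⟩
  -- The same `Q₀` bounds the catalyst at the input and tests it at the output; the identity Pauli
  -- has expectation 1, so the maximum is nonzero and can be cancelled.
  obtain ⟨Q₀, hQ₀⟩ := Finite.exists_max fun Q : Fin c → Pauli => v (pauliExp Q (density cat))
  set M := v (pauliExp Q₀ (density cat)) with hM
  have hM0 : 0 < M := by
    refine lt_of_lt_of_le ?_ (hQ₀ fun _ => Pauli.I)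
    rw [pauliExp_one_density hcat, map_one]
    exact zero_lt_one
  have hS : ∀ z ∈ v.leAddSubgroup ((v 2)⁻¹ ^ k * M),
      Complex.I * z ∈ v.leAddSubgroup ((v 2)⁻¹ ^ k * M) := fun z hz => by
    have : v (Complex.I * z) = v z := by
      rw [map_mul, valuation_eq_one_of_pow_eq_one v (by norm_num) Complex.I_pow_four, one_mul]
    exact this.le.trans hz
  have hin : PauliExpIn (v.leAddSubgroup ((v 2)⁻¹ ^ k * M))
      (density (tensor (tensorPow cczKet k) cat)) := fun P => by
    change v _ ≤ _
    rw [pauliExp_density_tensor, pauliExp_density_tensorPow, map_mul, map_prod]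
    refine mul_le_mul' ?_ (hQ₀ _)
    refine (Finset.prod_le_pow_card _ _ _ fun i _ => valuation_pauliExp_ccz_le v _).trans ?_
    simp
  -- The test observable is `X` on each target qubit and `Q₀` on the catalyst.
  have hfin := p.pauliExpIn_of_hasOutput hS hin hp hout
    (Fin.append (fun _ : Fin (n * 1) => Pauli.X) Q₀)
  change v _ ≤ _ at hfin
  rw [pauliExp_density_tensor, pauliExp_density_tensorPow, map_mul] at hfin
  simp only [Fin.append_left, Fin.append_right, pauliExp_X_phase, Finset.prod_const,
    Finset.card_univ, Fintype.card_fin, map_pow, ← hM] at hfin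
  exact le_of_mul_le_mul_right hfin hM0

theorem ConvertsCCZ.mul_two_pow_le {d : ℕ} (hd : 2 ≤ d) {j : ℤ} (hj : Odd j) {c : ℕ}
    {cat : Ket c} (hcat : IsUnitKet cat) {k n : ℕ}
    (h : ConvertsCCZ cat k n (Real.pi * j / 2 ^ d)) :
    n * 2 ^ (d - 1) ≤ n + k * 2 ^ (d - 1) := by
  obtain ⟨B, hB⟩ := exists_valuationSubring_two_lt_one
  set v := B.valuation
  have h2 : 0 < v 2 := (v.pos_iff).2 two_ne_zero
  have hle := h.valuation_cos_pow_le v hcat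
  have hcos := valuation_two_mul_cos_pow v hd hj
  push_cast at hle
  set w := v (Complex.cos (Real.pi * j / 2 ^ d))
  rw [map_mul] at hcos
  have h1 : (v 2 * w) ^ n * v 2 ^ k ≤ v 2 ^ n := by
    rw [mul_pow, mul_assoc]
    refine mul_le_of_le_one_right' ?_
    calc w ^ n * v 2 ^ k ≤ (v 2)⁻¹ ^ k * v 2 ^ k := by gcongr
      _ = 1 := by rw [← mul_pow, inv_mul_cancel₀ h2.ne', one_pow]
  -- Raising to the power `2 ^ (d - 1)` turns `v (2 cos θ)` into `v 2`; as `v 2 < 1`, exponents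
  -- compare in reverse.
  have h3 : v 2 ^ (n + k * 2 ^ (d - 1)) ≤ v 2 ^ (n * 2 ^ (d - 1)) := by
    have := pow_le_pow_left' h1 (2 ^ (d - 1))
    rwa [mul_pow, ← pow_mul, mul_comm n, pow_mul, hcos, ← pow_mul, ← pow_mul, ← pow_add] at this
  exact (pow_le_pow_iff_right_of_lt_one₀ h2 hB).1 h3

end Stab

theorem mainTheorem11 (d : ℕ) (hd : 2 ≤ d) (j : ℤ) (hj : Odd j) :
    (∀ (c : ℕ) (cat : Stab.Ket c) (k n : ℕ), Stab.IsDyadicState cat →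
      Stab.ConvertsCCZ cat k n (Real.pi * j / 2 ^ d) →
        (k : ℝ) ≥ n * (1 - 1 / 2 ^ (d - 1))) ∧
    (∀ k n : ℕ → ℕ, Filter.Tendsto n Filter.atTop Filter.atTop →
      (∀ i, ∃ (c : ℕ) (cat : Stab.Ket c), Stab.IsDyadicState cat ∧
        Stab.ConvertsCCZ cat (k i) (n i) (Real.pi * j / 2 ^ d)) →
      ((1 - 1 / 2 ^ (d - 1) : ℝ) : EReal) ≤
        Filter.liminf (fun i => (((k i : ℝ) / (n i : ℝ) : ℝ) : EReal)) Filter.atTop) := by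
  have key : ∀ (c : ℕ) (cat : Stab.Ket c) (k n : ℕ), Stab.IsDyadicState cat →
      Stab.ConvertsCCZ cat k n (Real.pi * j / 2 ^ d) →
        (k : ℝ) ≥ n * (1 - 1 / 2 ^ (d - 1)) := fun c cat k n hcat h => by
    have h1 : ((n * 2 ^ (d - 1) : ℕ) : ℝ) ≤ ((n + k * 2 ^ (d - 1) : ℕ) : ℝ) :=
      Nat.cast_le.2 (h.mul_two_pow_le hd hj hcat.1)
    push_cast at h1
    have h2 : (0 : ℝ) < 2 ^ (d - 1) := by positivity
    rw [ge_iff_le, ← mul_le_mul_iff_left₀ h2]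
    calc (n : ℝ) * (1 - 1 / 2 ^ (d - 1)) * 2 ^ (d - 1) = n * 2 ^ (d - 1) - n := by field_simp
      _ ≤ k * 2 ^ (d - 1) := by linarith
  refine ⟨key, fun k n hn h => ?_⟩
  refine Filter.le_liminf_of_le (by isBoundedDefault) ?_
  -- Only indices with `n i > 0` allow the division.
  filter_upwards [hn.eventually_gt_atTop 0] with i hi
  obtain ⟨c, cat, hcat, hconv⟩ := h i
  rw [EReal.coe_le_coe_iff, le_div_iff₀ (by exact_mod_cast hi), mul_comm]
  exact key c cat (k i) (n i) hcat hconv
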